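/- Let $H=\ell^2\times\ell^2$ be the real Hilbert space of pairs $z=(\xi,\eta)$ of square-summable real sequences, with $\langle(\xi,\eta),(\tilde\xi,\tilde\eta)\rangle=\sum_{j\ge1}(\xi_j\tilde\xi_j+\eta_j\tilde\eta_j)$. For real numbers $\omega_1,\omega_2,\dots$ let $\Omega=\mathrm{diag}(\omega_1,\omega_2,\dots)$ and consider the operator $$A(\xi,\eta)=(\Omega\eta,-\Omega\xi),\qquad D(A)=\Big\{(\xi,\eta)\in H:\ \sum_{j\ge1}\omega_j^2(\xi_j^2+\eta_j^2)<\infty\Big\}.$$ Let $r\in\mathbb N$, let $(c_{sj})$, $1\le s\le r$, $j\ge 1$, be real numbers with $\sum_j c_{sj}^2<\infty$ for each $s$, and let $C:H\to\mathbb R^r$ be the output operator $C(\xi,\eta)=C_1\xi=\big(\sum_{j}c_{sj}\xi_j\big)_{s=1}^r$. Let $F:\mathbb R^r\to H$, $Fy=(fy,gy)$, be the observer gain operator with the matrices $$f_{js}=\gamma_s c_{sj},\qquad g_{js}=0,\qquad \gamma_s>0\qquad(1\le s\le r,\ j\ge1).$$ For the control system $\dot z=Az+Bu$, $y=Cz$,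 and the Luenberger observer $\dot{\bar z}=(A-FC)\bar z+Bu+Fy$, the observation error $e=z-\bar z$ is governed by $$\dot e=(A-FC)e,\qquad D(A-FC)=D(A).\qquad(*)$$ Assume that 1. $0<\omega_1<\omega_2<\dots$; 2. $\sum_{j\ge1}\omega_j^{-2}<\infty$; 3. the only linear subspace of $\ker C$ that is invariant under the $C_0$-semigroup $\{e^{tA}\}_{t\ge0}$ generated by $A$ is $\{0\}$; 4. for each $j\ge1$ there is an $s\in\{1,\dots,r\}$ with $c_{sj}\ne0$. Then the zero solution of $(*)$ is asymptotically stable. That is, $A-FC$ generates a $C_0$-semigroup $\{S(t)\}_{t\ge0}$ on $H$, so that the solutions of $(*)$ are $e(t)=S(t)e(0)$, and: (i) for each $\varepsilon>0$ there is a $\delta>0$ such that $\|e(0)\|<\delta$ implies $\|e(t)\|<\varepsilon$ for all $t\ge0$; (ii) for every $e(0)\in H$, $\|e(t)\|\to0$ as $t\to\infty$. -/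

import Mathlib

open Filter Topology
open scoped NNReal InnerProductSpace

noncomputable section

namespace HamObs

/-- The real Hilbert space of square summable real sequences. -/
abbrev Ell2 : Type := lp (fun _ : ℕ => ℝ) 2

/-- The state space `ℓ² × ℓ²` with the inner product
`⟪(ξ, η), (ξ', η')⟫ = ∑ j, (ξ j * ξ' j + η j * η' j)`. -/
abbrev H : Type := WithLp 2 (Ell2 × Ell2)

/-! ### Strongly continuous semigroups -/

/-- A strongly continuous one-parameter semigroup of bounded linear operators. -/
structure C0Semigroup (X : Type*) [NormedAddCommGroup X] [NormedSpace ℝ X] where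
  /-- the operator at time `t` -/
  op : ℝ≥0 → X →L[ℝ] X
  op_zero : op 0 = ContinuousLinearMap.id ℝ X
  op_add : ∀ s t : ℝ≥0, op (s + t) = (op s).comp (op t)
  continuous_orbit : ∀ x : X, Continuous fun t : ℝ≥0 => op t x

namespace C0Semigroup

variable {X : Type*} [NormedAddCommGroup X] [NormedSpace ℝ X]

/-- The (in general unbounded) operator `A` is the infinitesimal generator of `S`: `x` lies in the
domain of `A` with `A x = y` exactly when `(S h x - x) / h` tends to `y` as `h → 0+`. -/
def IsGeneratedBy (S : C0Semigroup X) (A : X →ₗ.[ℝ] X) : Prop :=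
  ∀ x y : X, (x, y) ∈ A.graph ↔
    Tendsto (fun h : ℝ≥0 => (h : ℝ)⁻¹ • (S.op h x - x)) (𝓝[>] 0) (𝓝 y)

/-- The zero solution is stable in the sense of Lyapunov. -/
def IsStable (S : C0Semigroup X) : Prop :=
  ∀ ε : ℝ, 0 < ε → ∃ δ : ℝ, 0 < δ ∧ ∀ x : X, ‖x‖ < δ → ∀ t : ℝ≥0, ‖S.op t x‖ < ε

/-- Every trajectory tends to zero in norm. -/
def IsAttractive (S : C0Semigroup X) : Prop :=
  ∀ x : X, Tendsto (fun t : ℝ≥0 => ‖S.op t x‖) atTop (𝓝 0)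

end C0Semigroup

/-- The zero solution of the abstract linear differential equation `ė = A e` is asymptotically
stable: the equation is well posed (`A` generates a strongly continuous semigroup, whose orbits
`t ↦ S t e₀` are the solutions), the zero solution is Lyapunov stable, and every solution tends
to zero. -/
def AsymptoticallyStable {X : Type*} [NormedAddCommGroup X] [NormedSpace ℝ X]
    (A : X →ₗ.[ℝ] X) : Prop :=
  (∃ S : C0Semigroup X, S.IsGeneratedBy A) ∧
    ∀ S : C0Semigroup X, S.IsGeneratedBy A → S.IsStable ∧ S.IsAttractive

/-! ### The diagonal Hamiltonian operator -/

/-- The domain of `A`: all `(ξ, η)` with `∑ j, ω j ^ 2 * (ξ j ^ 2 + η j ^ 2) < ∞`. -/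
def hamDomain (ω : ℕ → ℝ) : Submodule ℝ H where
  carrier := {z | Summable fun j => ω j ^ 2 * (z.fst j ^ 2 + z.snd j ^ 2)}
  zero_mem' := by
    have h : (fun j => ω j ^ 2 * ((0 : H).fst j ^ 2 + (0 : H).snd j ^ 2)) = fun _ => 0 := by
      funext j; simp
    show Summable _
    rw [h]
    exact summable_zero
  add_mem' := by
    intro a b ha hb
    refine Summable.of_nonneg_of_le (fun j => by positivity) (fun j => ?_)
      ((Summable.add ha hb).mul_left 2)
    simp only [WithLp.add_fst, WithLp.add_snd, lp.coeFn_add, Pi.add_apply]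
    nlinarith [mul_nonneg (sq_nonneg (ω j)) (sq_nonneg (a.fst j - b.fst j)),
      mul_nonneg (sq_nonneg (ω j)) (sq_nonneg (a.snd j - b.snd j))]
  smul_mem' := by
    intro k a ha
    refine (Summable.mul_left (k ^ 2) ha).congr (fun j => ?_)
    simp only [WithLp.smul_fst, WithLp.smul_snd, lp.coeFn_smul, Pi.smul_apply, smul_eq_mul]
    ring

theorem memℓp_two_of_summable_sq {v : ℕ → ℝ} (h : Summable fun j => v j ^ 2) :
    Memℓp v 2 := by
  refine memℓp_gen (h.congr fun j => ?_)
  simp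

theorem memℓp_mul_fst {ω : ℕ → ℝ} {z : H} (hz : z ∈ hamDomain ω) :
    Memℓp (fun j => ω j * z.fst j) 2 := by
  refine memℓp_two_of_summable_sq
    (Summable.of_nonneg_of_le (fun j => by positivity) (fun j => ?_) hz)
  nlinarith [mul_nonneg (sq_nonneg (ω j)) (sq_nonneg (z.snd j))]

theorem memℓp_mul_snd {ω : ℕ → ℝ} {z : H} (hz : z ∈ hamDomain ω) :
    Memℓp (fun j => ω j * z.snd j) 2 := by
  refine memℓp_two_of_summable_sq
    (Summable.of_nonneg_of_le (fun j => by positivity) (fun j => ?_) hz)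
  nlinarith [mul_nonneg (sq_nonneg (ω j)) (sq_nonneg (z.fst j))]

/-- The unbounded operator `A (ξ, η) = (Ω η, -Ω ξ)` with `Ω = diag (ω 0, ω 1, …)` and domain
`hamDomain ω`. -/
def hamOp (ω : ℕ → ℝ) : H →ₗ.[ℝ] H where
  domain := hamDomain ω
  toFun :=
    { toFun := fun z => WithLp.toLp 2
        ((⟨fun j => ω j * (z : H).snd j, memℓp_mul_snd z.2⟩ : Ell2),
          -(⟨fun j => ω j * (z : H).fst j, memℓp_mul_fst z.2⟩ : Ell2))
      map_add' := by
        intro a b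
        refine WithLp.ofLp_injective 2 (Prod.ext (lp.ext (funext fun j => ?_))
          (lp.ext (funext fun j => ?_)))
        · show ω j * ((a : H).snd j + (b : H).snd j) = ω j * (a : H).snd j + ω j * (b : H).snd j
          ring
        · show -(ω j * ((a : H).fst j + (b : H).fst j))
            = -(ω j * (a : H).fst j) + -(ω j * (b : H).fst j)
          ring
      map_smul' := by
        intro k a
        refine WithLp.ofLp_injective 2 (Prod.ext (lp.ext (funext fun j => ?_))
          (lp.ext (funext fun j => ?_)))
        · show ω j * (k * (a : H).snd j) = k * (ω j * (a : H).snd j)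
          ring
        · show -(ω j * (k * (a : H).fst j)) = k * -(ω j * (a : H).fst j)
          ring }

/-! ### Output operator and observer gain -/

/-- The output operator `C (ξ, η) = C₁ ξ`, where the `s`-th row of the matrix `C₁` is the square
summable sequence `c s`; so the `s`-th output is `∑ j, c s j * ξ j`. -/
def outputOp {r : ℕ} (c : Fin r → Ell2) : H →ₗ[ℝ] EuclideanSpace ℝ (Fin r) where
  toFun z := WithLp.toLp 2 fun s => ⟪c s, z.fst⟫_ℝ
  map_add' a b := by ext s; simp [inner_add_right]
  map_smul' k a := by ext s; simp [inner_smul_right]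

/-- The gain operator `F y = (f y, g y)`, where the `s`-th columns of the matrices `f` and `g` are
the square summable sequences `f s` and `g s` (so the entry `f_{js}` is `f s j`). -/
def gainOp {r : ℕ} (f g : Fin r → Ell2) : EuclideanSpace ℝ (Fin r) →ₗ[ℝ] H where
  toFun y := WithLp.toLp 2 (∑ s, y s • f s, ∑ s, y s • g s)
  map_add' a b := by
    refine WithLp.ofLp_injective 2 (Prod.ext ?_ ?_) <;>
      simp [add_smul, Finset.sum_add_distrib]
  map_smul' k a := by
    refine WithLp.ofLp_injective 2 (Prod.ext ?_ ?_) <;>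
      simp [mul_smul, Finset.smul_sum]

/-- The operator `A - F C` of the observation error dynamics, with the domain of `A`. -/
def errorOp {r : ℕ} (ω : ℕ → ℝ) (c f g : Fin r → Ell2) : H →ₗ.[ℝ] H :=
  hamOp ω - ((gainOp f g).comp (outputOp c)).toPMap ⊤

/-- The only linear subspace of `Ker C` that is invariant under the semigroup generated by `A`
is `{0}`. -/
def NoInvariantSubspace {r : ℕ} (ω : ℕ → ℝ) (c : Fin r → Ell2) : Prop :=
  ∀ T : C0Semigroup H, T.IsGeneratedBy (hamOp ω) →
    ∀ V : Submodule ℝ H, V ≤ LinearMap.ker (outputOp c) →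
      (∀ t : ℝ≥0, ∀ x ∈ V, T.op t x ∈ V) → V = ⊥

end HamObs

end

/-! With b_s = (c_s, 0), the feedback term is FC = K = ∑ γ_s ⟪b_s, ·⟫ b_s, a bounded nonnegative
operator of finite rank, while A is skew. Hence ⟪x, (A - FC)x⟫ = -∑ γ_s (Cx)_s² ≤ 0 on the domain
(`inner_of_mem_graph_errorOp`). So ‖x‖² is a Lyapunov function, the semigroup is contractive, and
stability holds with δ = ε.

Generation: A generates an explicit group of rotations T(t). In the interaction picture S(t) =
T(t)U(t), the factor U solves U' = -T(-t) K T(t) U, a linear equation with a norm-continuous bounded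
coefficient, solved by a Dyson series (`exists_perturbed_semigroup`).

Attractivity is LaSalle's invariance principle. For x in the domain, A S(n)x stays bounded, and ∑
ω_j⁻² < ∞ makes such a sequence precompact (`exists_subseq_tendsto_of_graph_bounded`), so S(n)x has
a limit point z in the domain. The nonincreasing norm ‖S(t)x‖ has a limit l, so ‖S(t)z‖ = l for all
t. No dissipation along this orbit means that its output vanishes; the feedback is then inactive and
the orbit coincides with T(t)z. Thus z lies in a T-invariant subspace of ker C, so z = 0 and l = 0
(`eq_zero_of_norm_errorOp_semigroup_const`). Density of the domain and contractivity extend this to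
every initial value. -/

noncomputable section

namespace HamObs

/-! ### Linear differential equations in a Banach algebra -/

section Dyson

variable {𝔸 : Type*} [NormedRing 𝔸] [NormedAlgebra ℝ 𝔸]

/-- The terms of the Dyson series of the equation `U' = Q U`, `U 0 = 1`. -/
def dysonTerm (Q : ℝ → 𝔸) : ℕ → ℝ → 𝔸
  | 0, _ => 1
  | n + 1, t => ∫ s in (0 : ℝ)..t, Q s * dysonTerm Q n s

theorem continuous_dysonTerm {Q : ℝ → 𝔸} (hQ : Continuous Q) (n : ℕ) :
    Continuous (dysonTerm Q n) := by
  induction n with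
  | zero => exact continuous_const
  | succ n ih =>
    exact intervalIntegral.continuous_primitive
      (fun a b => (hQ.mul ih).intervalIntegrable a b) 0

theorem hasDerivAt_dysonTerm_succ [CompleteSpace 𝔸] {Q : ℝ → 𝔸} (hQ : Continuous Q) (n : ℕ) (t : ℝ) :
    HasDerivAt (dysonTerm Q (n + 1)) (Q t * dysonTerm Q n t) t :=
  (hQ.mul (continuous_dysonTerm hQ n)).integral_hasStrictDerivAt 0 t |>.hasDerivAt

/-- Time reversal yields an equation of the same type with coefficient -Q(-s), so norm bounds need
proof only for t ≥ 0. -/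
theorem dysonTerm_neg (Q : ℝ → 𝔸) (n : ℕ) (t : ℝ) :
    dysonTerm Q n (-t) = dysonTerm (fun s => -Q (-s)) n t := by
  induction n generalizing t with
  | zero => rfl
  | succ n ih =>
    simp only [dysonTerm, ← ih, neg_mul, intervalIntegral.integral_neg]
    rw [intervalIntegral.integral_comp_neg (fun s => Q s * dysonTerm Q n s), neg_zero,
      intervalIntegral.integral_symm]

theorem norm_dysonTerm_le_of_nonneg {Q : ℝ → 𝔸} {M : ℝ} (hM : ∀ t, ‖Q t‖ ≤ M) (n : ℕ)
    {t : ℝ} (ht : 0 ≤ t) : ‖dysonTerm Q n t‖ ≤ ‖(1 : 𝔸)‖ * ((M * t) ^ n / n.factorial) := by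
  have hM0 : 0 ≤ M := (norm_nonneg _).trans (hM 0)
  induction n generalizing t with
  | zero => simp [dysonTerm]
  | succ n ih =>
    have h1 : ‖dysonTerm Q (n + 1) t‖
        ≤ ∫ s in (0 : ℝ)..t, M * (‖(1 : 𝔸)‖ * ((M * s) ^ n / n.factorial)) := by
      refine intervalIntegral.norm_integral_le_of_norm_le ht (.of_forall fun s hs => ?_)
        (Continuous.intervalIntegrable (by fun_prop) _ _)
      exact (norm_mul_le _ _).trans (mul_le_mul (hM s) (ih hs.1.le) (norm_nonneg _) hM0)
    refine h1.trans_eq ?_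
    have h2 : (fun s : ℝ => M * (‖(1 : 𝔸)‖ * ((M * s) ^ n / n.factorial)))
        = fun s => (M ^ (n + 1) * ‖(1 : 𝔸)‖ / n.factorial) * s ^ n := by
      funext s; rw [mul_pow]; ring
    rw [h2, intervalIntegral.integral_const_mul, integral_pow, Nat.factorial_succ]
    push_cast
    have : (n.factorial : ℝ) ≠ 0 := by positivity
    field_simp
    ring

theorem norm_dysonTerm_le {Q : ℝ → 𝔸} {M : ℝ} (hM : ∀ t, ‖Q t‖ ≤ M) (n : ℕ) (t : ℝ) :
    ‖dysonTerm Q n t‖ ≤ ‖(1 : 𝔸)‖ * ((M * |t|) ^ n / n.factorial) := by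
  rcases le_total 0 t with ht | ht
  · rw [abs_of_nonneg ht]; exact norm_dysonTerm_le_of_nonneg hM n ht
  · rw [abs_of_nonpos ht, ← neg_neg t, dysonTerm_neg, neg_neg]
    exact norm_dysonTerm_le_of_nonneg (fun s => by simpa using hM (-s)) n (neg_nonneg.2 ht)

/-- A linear differential equation with bounded continuous coefficients in a Banach algebra has a
global fundamental solution. -/
theorem exists_fundamental_solution [CompleteSpace 𝔸] {Q : ℝ → 𝔸} (hQ : Continuous Q) {M : ℝ}
    (hM : ∀ t, ‖Q t‖ ≤ M) :
    ∃ U : ℝ → 𝔸, U 0 = 1 ∧ ∀ t, HasDerivAt U (Q t * U t) t := by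
  have hM0 : 0 ≤ M := (norm_nonneg _).trans (hM 0)
  have hexp (R : ℝ) : Summable fun n : ℕ => ‖(1 : 𝔸)‖ * ((M * R) ^ n / n.factorial) :=
    (Real.summable_pow_div_factorial _).mul_left _
  have hs (t : ℝ) : Summable fun n => dysonTerm Q n t :=
    Summable.of_norm_bounded (hexp |t|) fun n => norm_dysonTerm_le hM n t
  have h0 (n : ℕ) : dysonTerm Q (n + 1) 0 = 0 := by simp [dysonTerm]
  -- The constant zeroth term is split off: the derivative of term n + 1 is Q times term n, so
  -- differentiating the remaining series termwise gives Q times the full series.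
  refine ⟨fun t => 1 + ∑' n, dysonTerm Q (n + 1) t, by simp [h0], fun t => ?_⟩
  have hU : 1 + ∑' n, dysonTerm Q (n + 1) t = ∑' n, dysonTerm Q n t :=
    ((hs t).tsum_eq_zero_add).symm
  show HasDerivAt _ (Q t * (1 + ∑' n, dysonTerm Q (n + 1) t)) t
  rw [hU, ← (hs t).tsum_mul_left (Q t)]
  refine HasDerivAt.const_add 1 ?_
  -- The ball only has to contain 0 and t; on it the exponential majorant of the differentiated
  -- series is uniform.
  refine hasDerivAt_tsum_of_isPreconnected (t := Metric.ball 0 (|t| + 1)) (y₀ := 0)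
    ((hexp (|t| + 1)).mul_left M) Metric.isOpen_ball (convex_ball _ _).isPreconnected
    (fun n y _ => hasDerivAt_dysonTerm_succ hQ n y) (fun n y hy => ?_)
    (Metric.mem_ball_self (by positivity)) (by simp [h0]) (by simp)
  have hy' : |y| ≤ |t| + 1 := by simpa using (Metric.mem_ball.1 hy).le
  refine (norm_mul_le _ _).trans (mul_le_mul (hM y) ((norm_dysonTerm_le hM n y).trans ?_)
    (norm_nonneg _) hM0)
  gcongr

end Dyson

/-! ### Bounded perturbations of unitary groups -/

section Perturbation

variable {X : Type*} [NormedAddCommGroup X] [InnerProductSpace ℝ X]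

/-- The finite rank operator `∑ s, γ s ⟪b s, ·⟫ b s`. -/
def finRankOp {r : ℕ} (γ : Fin r → ℝ) (b : Fin r → X) : X →L[ℝ] X :=
  ∑ s, γ s • InnerProductSpace.rankOne ℝ (b s) (b s)

theorem finRankOp_apply {r : ℕ} (γ : Fin r → ℝ) (b : Fin r → X) (x : X) :
    finRankOp γ b x = ∑ s, γ s • ⟪b s, x⟫_ℝ • b s := by
  simp [finRankOp]

/-- Passing to T(-t)S(t) removes the unbounded generator and leaves an equation with bounded
coefficients. The conclusion says that the generator of S is that of T minus K, with the same
domain. -/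
theorem exists_perturbed_semigroup [CompleteSpace X] {r : ℕ} (γ : Fin r → ℝ) (b : Fin r → X)
    (T : ℝ → X →L[ℝ] X) (T_zero : T 0 = 1) (T_add : ∀ s t, T (s + t) = T s * T t)
    (T_norm : ∀ t x, ‖T t x‖ = ‖x‖) (T_cont : ∀ x, Continuous fun t => T t x) :
    ∃ S : C0Semigroup X, ∀ x y : X,
      Tendsto (fun h : ℝ≥0 => (h : ℝ)⁻¹ • (S.op h x - x)) (𝓝[>] 0) (𝓝 y) ↔
      Tendsto (fun h : ℝ≥0 => (h : ℝ)⁻¹ • (T h x - x)) (𝓝[>] 0)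
        (𝓝 (y + finRankOp γ b x)) := by
  set K := finRankOp γ b with hK
  have T_neg (t : ℝ) : T t * T (-t) = 1 := by rw [← T_add, add_neg_cancel, T_zero]
  have T_neg' (t : ℝ) : T (-t) * T t = 1 := by rw [← T_add, neg_add_cancel, T_zero]
  have T_negx (t : ℝ) (x : X) : T t (T (-t) x) = x := congrArg (fun L => L x) (T_neg t)
  have T_inner (t : ℝ) (x y : X) : ⟪T t x, T t y⟫_ℝ = ⟪x, y⟫_ℝ :=
    ({ toLinearMap := T t, norm_map' := T_norm t } : X →ₗᵢ[ℝ] X).inner_map_map x y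
  have T_le (t : ℝ) : ‖T t‖ ≤ 1 :=
    ContinuousLinearMap.opNorm_le_bound _ zero_le_one fun x => by rw [T_norm, one_mul]
  set Q : ℝ → X →L[ℝ] X := fun t => -(T (-t) * K * T t) with hQdef
  have hQcont : Continuous Q := by
    -- T is only strongly continuous. Written as a sum of rank-one operators in the moving vectors
    -- T(-t)b_s, the coefficient Q is continuous in operator norm.
    have h (t : ℝ) : Q t
        = -∑ s, γ s • InnerProductSpace.rankOne ℝ (T (-t) (b s)) (T (-t) (b s)) := by
      ext x
      show -(T (-t) (K (T t x))) = _
      simp only [hK, neg_apply, finRankOp_apply, map_sum, map_smul, sum_apply, smul_apply,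
        InnerProductSpace.rankOne_apply]
      congr 1
      refine Finset.sum_congr rfl fun s _ => ?_
      rw [← T_inner t (T (-t) (b s)) x, T_negx]
    rw [show Q = fun t => -∑ s, γ s • InnerProductSpace.rankOne ℝ (T (-t) (b s)) (T (-t) (b s))
      from funext h]
    have hb (s : Fin r) : Continuous fun t => T (-t) (b s) := (T_cont (b s)).comp continuous_neg
    refine Continuous.neg (continuous_finsetSum _ fun s _ => Continuous.const_smul ?_ (γ s))
    exact ((InnerProductSpace.rankOne ℝ).continuous.comp (hb s)).clm_apply (hb s)
  have hQle (t : ℝ) : ‖Q t‖ ≤ ‖K‖ := by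
    rw [hQdef, norm_neg]
    calc ‖T (-t) * K * T t‖ ≤ ‖T (-t)‖ * ‖K‖ * ‖T t‖ :=
          (norm_mul_le _ _).trans (mul_le_mul_of_nonneg_right (norm_mul_le _ _) (norm_nonneg _))
      _ ≤ 1 * ‖K‖ * 1 := by gcongr <;> exact T_le _
      _ = ‖K‖ := by ring
  obtain ⟨U, hU0, hU⟩ := exists_fundamental_solution hQcont hQle
  have hUcont : Continuous U := continuous_iff_continuousAt.2 fun t => (hU t).continuousAt
  -- Joint continuity of (t, v) ↦ T(t)v: since T is isometric, T(tᵢ)(vᵢ - w) has norm ‖vᵢ - w‖.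
  have T_lim {ι : Type} {l : Filter ι} {t : ι → ℝ} {t₀ : ℝ} {v : ι → X} {w : X}
      (ht : Tendsto t l (𝓝 t₀)) (hv : Tendsto v l (𝓝 w)) :
      Tendsto (fun i => T (t i) (v i)) l (𝓝 (T t₀ w)) := by
    have h1 : Tendsto (fun i => T (t i) (v i - w)) l (𝓝 0) := by
      rw [tendsto_zero_iff_norm_tendsto_zero]
      simp only [T_norm]
      exact tendsto_iff_norm_sub_tendsto_zero.1 hv
    simpa using h1.add (((T_cont w).tendsto t₀).comp ht)
  -- The cocycle identity behind the semigroup law of T(t)U(t): as functions of s, both sides solve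
  -- V' = Q(s + t)V and equal U(t) at s = 0.
  have hmul (s t : ℝ) : U (s + t) = T (-t) * U s * T t * U t := by
    have hlip (s : ℝ) : LipschitzOnWith ‖K‖₊ (fun V => Q (s + t) * V) Set.univ := by
      refine (LipschitzWith.of_dist_le_mul fun V W => ?_).lipschitzOnWith
      rw [dist_eq_norm, dist_eq_norm, ← mul_sub]
      exact (norm_mul_le _ _).trans (mul_le_mul_of_nonneg_right (hQle _) (norm_nonneg _))
    have := ODE_solution_unique_univ (v := fun s V => Q (s + t) * V) (s := fun _ => Set.univ)
      (f := fun s => U (s + t)) (g := fun s => T (-t) * U s * T t * U t) (t₀ := 0) hlip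
      (fun s => ⟨(hU (s + t)).comp_add_const s t, trivial⟩)
      (fun s => ⟨?_, trivial⟩) (by simp [hU0, T_neg'])
    · exact congrFun this s
    · have h := (((hU s).const_mul (T (-t))).mul_const (T t)).mul_const (U t)
      have e (Y : X →L[ℝ] X) : T t * (T (-t) * Y) = Y := by rw [← mul_assoc, T_neg, one_mul]
      have h2 : Q (s + t) * (T (-t) * U s * T t * U t) = T (-t) * (Q s * U s) * T t * U t := by
        simp only [hQdef]
        rw [neg_add, T_add s t, add_comm (-s), T_add (-t) (-s)]
        simp only [mul_assoc, neg_mul, mul_neg, e]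
      show HasDerivAt _ (Q (s + t) * (T (-t) * U s * T t * U t)) s
      rw [h2]
      exact h
  refine ⟨⟨fun t => T t * U t, ?_, fun s t => ?_, fun x => ?_⟩, fun x y => ?_⟩
  · simp [T_zero, hU0]; rfl
  · show T ((s + t : ℝ≥0) : ℝ) * U ((s + t : ℝ≥0) : ℝ) = (T s * U s) * (T t * U t)
    have e (Y : X →L[ℝ] X) : T t * (T (-t) * Y) = Y := by rw [← mul_assoc, T_neg, one_mul]
    rw [NNReal.coe_add, hmul, T_add]
    simp only [mul_assoc, e]
  · refine continuous_iff_continuousAt.2 fun t => ?_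
    exact T_lim (NNReal.continuous_coe.tendsto t)
      (((hUcont.clm_apply continuous_const).comp NNReal.continuous_coe).tendsto t)
  · have hcoe : Tendsto (fun h : ℝ≥0 => (h : ℝ)) (𝓝[>] 0) (𝓝[≠] 0) := by
      refine tendsto_nhdsWithin_iff.2
        ⟨(NNReal.continuous_coe.tendsto 0).mono_left nhdsWithin_le_nhds, ?_⟩
      filter_upwards [self_mem_nhdsWithin] with h hh
      exact (NNReal.coe_pos.2 hh).ne'
    have hUx : HasDerivAt (fun t => U t x) (-K x) 0 := by
      have h1 := (hU 0).clm_apply (hasDerivAt_const (0 : ℝ) x)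
      simpa [hQdef, hU0, T_zero] using h1
    have h1 : Tendsto (fun h : ℝ≥0 => (h : ℝ)⁻¹ • (U h x - x)) (𝓝[>] 0) (𝓝 (-K x)) := by
      have := hUx.tendsto_slope_zero.comp hcoe
      simpa [Function.comp_def, hU0] using this
    have h2 : Tendsto (fun h : ℝ≥0 => T h ((h : ℝ)⁻¹ • (U h x - x))) (𝓝[>] 0) (𝓝 (-K x)) := by
      have := T_lim (hcoe.mono_right nhdsWithin_le_nhds) h1
      simpa [T_zero] using this
    have h3 (h : ℝ≥0) : (h : ℝ)⁻¹ • ((T h * U h) x - x)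
        = T h ((h : ℝ)⁻¹ • (U h x - x)) + (h : ℝ)⁻¹ • (T h x - x) := by
      rw [map_smul, map_sub, ← smul_add, sub_add_sub_cancel]; rfl
    simp only [h3]
    constructor
    · intro h
      simpa using h.sub h2
    · intro h
      simpa using h2.add h

end Perturbation

/-! ### Coordinates in the state space -/

theorem H_ext {z w : H} (h₁ : ∀ j, z.fst j = w.fst j) (h₂ : ∀ j, z.snd j = w.snd j) : z = w :=
  WithLp.ofLp_injective 2 (Prod.ext (lp.ext (funext h₁)) (lp.ext (funext h₂)))

/-- The element of the state space with given coordinates. -/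
def ofCoords (a b : ℕ → ℝ) (h : Summable fun j => a j ^ 2 + b j ^ 2) : H :=
  WithLp.toLp 2
    ((⟨a, memℓp_two_of_summable_sq (h.of_nonneg_of_le (fun j => sq_nonneg (a j))
        fun j => le_add_of_nonneg_right (sq_nonneg (b j)))⟩ : Ell2),
      (⟨b, memℓp_two_of_summable_sq (h.of_nonneg_of_le (fun j => sq_nonneg (b j))
        fun j => le_add_of_nonneg_left (sq_nonneg (a j)))⟩ : Ell2))

theorem hasSum_coord_inner (z w : H) :
    HasSum (fun j => z.fst j * w.fst j + z.snd j * w.snd j) ⟪z, w⟫_ℝ := by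
  rw [WithLp.prod_inner_apply]
  refine ((lp.hasSum_inner z.fst w.fst).add (lp.hasSum_inner z.snd w.snd)).congr_fun ?_
  intro j
  simp [mul_comm]

theorem hasSum_coord_norm_sq (z : H) :
    HasSum (fun j => z.fst j ^ 2 + z.snd j ^ 2) (‖z‖ ^ 2) := by
  rw [← real_inner_self_eq_norm_sq]
  simpa only [pow_two] using hasSum_coord_inner z z

theorem coord_sq_le_norm_sq (z : H) (j : ℕ) : z.fst j ^ 2 + z.snd j ^ 2 ≤ ‖z‖ ^ 2 :=
  le_hasSum (hasSum_coord_norm_sq z) j fun _ _ => by positivity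

theorem continuous_fst_coord (j : ℕ) : Continuous fun z : H => z.fst j := by
  refine AddMonoidHomClass.continuous_of_bound
    ({ toFun := fun z : H => z.fst j, map_add' := fun _ _ => rfl,
       map_smul' := fun _ _ => rfl } : H →ₗ[ℝ] ℝ) 1 fun z => ?_
  rw [one_mul]
  have h : z.fst j ^ 2 ≤ ‖z‖ ^ 2 := by
    linarith [coord_sq_le_norm_sq z j, sq_nonneg (z.snd j)]
  exact abs_le_of_sq_le_sq h (norm_nonneg z)

theorem continuous_snd_coord (j : ℕ) : Continuous fun z : H => z.snd j := by
  refine AddMonoidHomClass.continuous_of_bound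
    ({ toFun := fun z : H => z.snd j, map_add' := fun _ _ => rfl,
       map_smul' := fun _ _ => rfl } : H →ₗ[ℝ] ℝ) 1 fun z => ?_
  rw [one_mul]
  have h : z.snd j ^ 2 ≤ ‖z‖ ^ 2 := by
    linarith [coord_sq_le_norm_sq z j, sq_nonneg (z.fst j)]
  exact abs_le_of_sq_le_sq h (norm_nonneg z)

/-- Coordinatewise convergence under a summable majorant implies convergence in norm. -/
theorem tendsto_of_coord {ι : Type*} {l : Filter ι} {F : ι → H} {z : H} {B : ℕ → ℝ}
    (hB : Summable B) (h₁ : ∀ j, Tendsto (fun i => (F i).fst j) l (𝓝 (z.fst j)))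
    (h₂ : ∀ j, Tendsto (fun i => (F i).snd j) l (𝓝 (z.snd j)))
    (hF : ∀ᶠ i in l, ∀ j, (F i).fst j ^ 2 + (F i).snd j ^ 2 ≤ B j) :
    Tendsto F l (𝓝 z) := by
  have key : Tendsto (fun i => ‖F i - z‖ ^ 2) l (𝓝 0) := by
    have h := tendsto_tsum_of_dominated_convergence (𝓕 := l)
      (f := fun i j => ((F i).fst j - z.fst j) ^ 2 + ((F i).snd j - z.snd j) ^ 2)
      (g := fun _ => (0 : ℝ)) (bound := fun j => 2 * B j + 2 * (z.fst j ^ 2 + z.snd j ^ 2))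
      ((hB.mul_left 2).add ((hasSum_coord_norm_sq z).summable.mul_left 2))
      (fun j => ?_) ?_
    · rw [tsum_zero] at h
      refine h.congr fun i => ?_
      exact (hasSum_coord_norm_sq (F i - z)).tsum_eq
    · have a := (((h₁ j).sub_const (z.fst j)).pow 2).add (((h₂ j).sub_const (z.snd j)).pow 2)
      simpa using a
    · filter_upwards [hF] with i hi j
      rw [Real.norm_of_nonneg (by positivity)]
      nlinarith [hi j, sq_nonneg ((F i).fst j + z.fst j), sq_nonneg ((F i).snd j + z.snd j)]
  rw [tendsto_iff_norm_sub_tendsto_zero]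
  simpa [Real.sqrt_sq (norm_nonneg _)] using key.sqrt

/-! ### The unitary group generated by the Hamiltonian operator -/

/-- Domain membership need not be demanded separately: square summability of the coordinates of y is
exactly the domain condition on z. -/
theorem mem_graph_hamOp {ω : ℕ → ℝ} {z y : H} :
    (z, y) ∈ (hamOp ω).graph ↔
      ∀ j, y.fst j = ω j * z.snd j ∧ y.snd j = -(ω j * z.fst j) := by
  rw [LinearPMap.mem_graph_iff]
  constructor
  · rintro ⟨x, rfl, rfl⟩ j
    exact ⟨rfl, rfl⟩
  · intro h
    have hz : z ∈ hamDomain ω := by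
      refine (hasSum_coord_norm_sq y).summable.congr fun j => ?_
      rw [(h j).1, (h j).2]; ring
    exact ⟨⟨z, hz⟩, rfl, H_ext (fun j => (h j).1.symm) fun j => (h j).2.symm⟩

/-- The generator is skew. -/
theorem inner_eq_zero_of_mem_graph_hamOp {ω : ℕ → ℝ} {z y : H} (h : (z, y) ∈ (hamOp ω).graph) :
    ⟪z, y⟫_ℝ = 0 := by
  rw [mem_graph_hamOp] at h
  refine (hasSum_coord_inner z y).unique (hasSum_zero.congr_fun fun j => ?_)
  rw [(h j).1, (h j).2]; ring

theorem rotation_sq (θ a b : ℝ) :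
    (Real.cos θ * a + Real.sin θ * b) ^ 2 + (-Real.sin θ * a + Real.cos θ * b) ^ 2
      = a ^ 2 + b ^ 2 := by
  linear_combination (a ^ 2 + b ^ 2) * Real.sin_sq_add_cos_sq θ

/-- The flow of `ξ' = Ω η`, `η' = -Ω ξ`. -/
def rotation (ω : ℕ → ℝ) (t : ℝ) : H →ₗᵢ[ℝ] H where
  toFun z := ofCoords
    (fun j => Real.cos (ω j * t) * z.fst j + Real.sin (ω j * t) * z.snd j)
    (fun j => -Real.sin (ω j * t) * z.fst j + Real.cos (ω j * t) * z.snd j)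
    ((hasSum_coord_norm_sq z).summable.congr fun j => (rotation_sq _ _ _).symm)
  map_add' z w := by
    refine H_ext (fun j => ?_) fun j => ?_
    · show Real.cos (ω j * t) * (z.fst j + w.fst j) + Real.sin (ω j * t) * (z.snd j + w.snd j)
        = (Real.cos (ω j * t) * z.fst j + Real.sin (ω j * t) * z.snd j)
          + (Real.cos (ω j * t) * w.fst j + Real.sin (ω j * t) * w.snd j)
      ring
    · show -Real.sin (ω j * t) * (z.fst j + w.fst j) + Real.cos (ω j * t) * (z.snd j + w.snd j)
        = (-Real.sin (ω j * t) * z.fst j + Real.cos (ω j * t) * z.snd j)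
          + (-Real.sin (ω j * t) * w.fst j + Real.cos (ω j * t) * w.snd j)
      ring
  map_smul' k z := by
    refine H_ext (fun j => ?_) fun j => ?_
    · show Real.cos (ω j * t) * (k * z.fst j) + Real.sin (ω j * t) * (k * z.snd j)
        = k * (Real.cos (ω j * t) * z.fst j + Real.sin (ω j * t) * z.snd j)
      ring
    · show -Real.sin (ω j * t) * (k * z.fst j) + Real.cos (ω j * t) * (k * z.snd j)
        = k * (-Real.sin (ω j * t) * z.fst j + Real.cos (ω j * t) * z.snd j)
      ring
  norm_map' z := by
    refine (pow_left_inj₀ (norm_nonneg _) (norm_nonneg _) two_ne_zero).1 ?_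
    refine (hasSum_coord_norm_sq _).unique ((hasSum_coord_norm_sq z).congr_fun fun j => ?_)
    exact rotation_sq _ _ _

theorem rotation_fst (ω : ℕ → ℝ) (t : ℝ) (z : H) (j : ℕ) :
    (rotation ω t z).fst j = Real.cos (ω j * t) * z.fst j + Real.sin (ω j * t) * z.snd j := rfl

theorem rotation_snd (ω : ℕ → ℝ) (t : ℝ) (z : H) (j : ℕ) :
    (rotation ω t z).snd j = -Real.sin (ω j * t) * z.fst j + Real.cos (ω j * t) * z.snd j := rfl

theorem rotation_zero (ω : ℕ → ℝ) (z : H) : rotation ω 0 z = z := by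
  refine H_ext (fun j => ?_) fun j => ?_
  · simp [rotation_fst]
  · simp [rotation_snd]

theorem rotation_add (ω : ℕ → ℝ) (s t : ℝ) (z : H) :
    rotation ω (s + t) z = rotation ω s (rotation ω t z) := by
  refine H_ext (fun j => ?_) fun j => ?_
  · simp only [rotation_fst, rotation_snd, mul_add, Real.cos_add, Real.sin_add]; ring
  · simp only [rotation_fst, rotation_snd, mul_add, Real.cos_add, Real.sin_add]; ring

theorem continuous_rotation (ω : ℕ → ℝ) (z : H) : Continuous fun t => rotation ω t z := by
  refine continuous_iff_continuousAt.2 fun t => ?_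
  refine tendsto_of_coord (hasSum_coord_norm_sq z).summable (fun j => ?_) (fun j => ?_)
    (.of_forall fun t j => (rotation_sq _ _ _).le)
  · have : Continuous fun t => (rotation ω t z).fst j := by
      simp only [rotation_fst]; fun_prop
    exact this.tendsto t
  · have : Continuous fun t => (rotation ω t z).snd j := by
      simp only [rotation_snd]; fun_prop
    exact this.tendsto t

theorem tendsto_coe_nhdsGT_zero :
    Tendsto (fun h : ℝ≥0 => (h : ℝ)) (𝓝[>] 0) (𝓝[>] 0) := by
  refine tendsto_nhdsWithin_iff.2
    ⟨(NNReal.continuous_coe.tendsto 0).mono_left nhdsWithin_le_nhds, ?_⟩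
  filter_upwards [self_mem_nhdsWithin] with h hh
  exact NNReal.coe_pos.2 hh

theorem tendsto_coe_nhdsNE_zero :
    Tendsto (fun h : ℝ≥0 => (h : ℝ)) (𝓝[>] 0) (𝓝[≠] 0) :=
  tendsto_coe_nhdsGT_zero.mono_right (nhdsWithin_mono _ fun _ h => (ne_of_gt h))

theorem mem_graph_hamOp_iff_tendsto_rotation (ω : ℕ → ℝ) (z y : H) :
    (z, y) ∈ (hamOp ω).graph ↔
      Tendsto (fun h : ℝ≥0 => (h : ℝ)⁻¹ • (rotation ω h z - z)) (𝓝[>] 0) (𝓝 y) := by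
  have d₁ (j : ℕ) : Tendsto (fun h : ℝ≥0 => ((h : ℝ)⁻¹ • (rotation ω h z - z)).fst j) (𝓝[>] 0)
      (𝓝 (ω j * z.snd j)) := by
    have hd : HasDerivAt (fun t => (rotation ω t z).fst j) (ω j * z.snd j) 0 := by
      have h0 := (hasDerivAt_id (0 : ℝ)).const_mul (ω j)
      exact ((h0.cos.mul_const (z.fst j)).add (h0.sin.mul_const (z.snd j))).congr_deriv
        (by simp)
    have := hd.tendsto_slope_zero.comp tendsto_coe_nhdsNE_zero
    simp only [Function.comp_def, zero_add, rotation_zero] at this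
    exact this
  have d₂ (j : ℕ) : Tendsto (fun h : ℝ≥0 => ((h : ℝ)⁻¹ • (rotation ω h z - z)).snd j) (𝓝[>] 0)
      (𝓝 (-(ω j * z.fst j))) := by
    have hd : HasDerivAt (fun t => (rotation ω t z).snd j) (-(ω j * z.fst j)) 0 := by
      have h0 := (hasDerivAt_id (0 : ℝ)).const_mul (ω j)
      exact ((h0.sin.neg.mul_const (z.fst j)).add (h0.cos.mul_const (z.snd j))).congr_deriv
        (by simp)
    have := hd.tendsto_slope_zero.comp tendsto_coe_nhdsNE_zero
    simp only [Function.comp_def, zero_add, rotation_zero] at this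
    exact this
  rw [mem_graph_hamOp]
  constructor
  · intro h
    refine tendsto_of_coord (hasSum_coord_norm_sq y).summable (fun j => (h j).1 ▸ d₁ j)
      (fun j => (h j).2 ▸ d₂ j) ?_
    filter_upwards [self_mem_nhdsWithin] with t ht j
    have ht' : (0 : ℝ) < t := NNReal.coe_pos.2 ht
    rw [(h j).1, (h j).2]
    show ((t : ℝ)⁻¹ * (Real.cos (ω j * t) * z.fst j + Real.sin (ω j * t) * z.snd j - z.fst j)) ^ 2
      + ((t : ℝ)⁻¹ * (-Real.sin (ω j * t) * z.fst j + Real.cos (ω j * t) * z.snd j - z.snd j)) ^ 2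
      ≤ _
    -- A rotation by θ moves a planar vector by squared distance (2 - 2 cos θ) times its squared
    -- length, at most θ² times it. The difference quotients are therefore dominated coordinatewise
    -- by y.
    have e : ((t : ℝ)⁻¹ * (Real.cos (ω j * t) * z.fst j + Real.sin (ω j * t) * z.snd j
          - z.fst j)) ^ 2
        + ((t : ℝ)⁻¹ * (-Real.sin (ω j * t) * z.fst j + Real.cos (ω j * t) * z.snd j
          - z.snd j)) ^ 2
        = (t : ℝ)⁻¹ ^ 2 * ((2 - 2 * Real.cos (ω j * t)) * (z.fst j ^ 2 + z.snd j ^ 2)) := by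
      linear_combination (t : ℝ)⁻¹ ^ 2 * (z.fst j ^ 2 + z.snd j ^ 2)
        * Real.sin_sq_add_cos_sq (ω j * t)
    have c := Real.one_sub_sq_div_two_le_cos (x := ω j * t)
    rw [e]
    calc _ ≤ (t : ℝ)⁻¹ ^ 2 * ((ω j * t) ^ 2 * (z.fst j ^ 2 + z.snd j ^ 2)) := by
            gcongr; linarith
      _ = _ := by field_simp; ring
  · intro h j
    exact ⟨tendsto_nhds_unique (((continuous_fst_coord j).tendsto y).comp h) (d₁ j),
      tendsto_nhds_unique (((continuous_snd_coord j).tendsto y).comp h) (d₂ j)⟩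

/-- The semigroup generated by the Hamiltonian operator. -/
def hamSemigroup (ω : ℕ → ℝ) : C0Semigroup H where
  op t := (rotation ω t).toContinuousLinearMap
  op_zero := by ext1 z; exact rotation_zero ω z
  op_add s t := by ext1 z; exact rotation_add ω s t z
  continuous_orbit z := (continuous_rotation ω z).comp NNReal.continuous_coe

theorem hamSemigroup_isGeneratedBy (ω : ℕ → ℝ) : (hamSemigroup ω).IsGeneratedBy (hamOp ω) :=
  mem_graph_hamOp_iff_tendsto_rotation ω

theorem dense_hamDomain (ω : ℕ → ℝ) : Dense (hamDomain ω : Set H) := by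
  rw [Submodule.dense_iff_topologicalClosure_eq_top, Submodule.topologicalClosure_eq_top_iff,
    Submodule.eq_bot_iff]
  intro v hv
  rw [Submodule.mem_orthogonal] at hv
  have hs (j : ℕ) (a b : ℝ) : a * v.fst j + b * v.snd j = 0 := by
    set w := ofCoords (fun i => if i = j then a else 0) (fun i => if i = j then b else 0)
      (summable_of_ne_finset_zero (s := {j}) fun i hi => by simp_all) with hw
    have h1 := hv w (by
      refine summable_of_ne_finset_zero (s := {j}) fun i hi => ?_
      show ω i ^ 2 * ((if i = j then a else 0) ^ 2 + (if i = j then b else 0) ^ 2) = 0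
      simp_all)
    have h2 := (hasSum_coord_inner w v).unique (hasSum_single j fun i hi => by
      show (if i = j then a else 0) * v.fst i + (if i = j then b else 0) * v.snd i = 0
      simp [hi])
    rw [h1] at h2
    have h3 : (0 : ℝ) = (if j = j then a else 0) * v.fst j + (if j = j then b else 0) * v.snd j :=
      h2
    simpa using h3.symm
  exact H_ext (fun j => by simpa using hs j 1 0) fun j => by simpa using hs j 0 1

/-! ### Trajectories of strongly continuous semigroups -/

/-- A function on `[0, ∞)` with nonpositive right derivative stays below its initial value. -/
theorem le_of_right_deriv_nonpos {g g' : ℝ → ℝ} (hg : Continuous g)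
    (hd : ∀ t, 0 ≤ t → HasDerivWithinAt g (g' t) (Set.Ici t) t) (h : ∀ t, 0 ≤ t → g' t ≤ 0)
    {t : ℝ} (ht : 0 ≤ t) : g t ≤ g 0 :=
  image_le_of_deriv_right_le_deriv_boundary (a := 0) (b := t) hg.continuousOn
    (fun x hx => hd x hx.1) (B := fun _ => g 0) (B' := fun _ => 0) le_rfl continuousOn_const
    (fun x _ => hasDerivWithinAt_const _ _ _) (fun x hx => h x hx.1) ⟨ht, le_rfl⟩

namespace C0Semigroup

section Generator

variable {X : Type*} [NormedAddCommGroup X] [NormedSpace ℝ X]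

theorem op_add_apply (S : C0Semigroup X) (s t : ℝ≥0) (x : X) :
    S.op (s + t) x = S.op s (S.op t x) := by rw [S.op_add]; rfl

theorem op_zero_apply (S : C0Semigroup X) (x : X) : S.op 0 x = x := by rw [S.op_zero]; rfl

theorem IsGeneratedBy.op_mem_graph {S : C0Semigroup X} {A : X →ₗ.[ℝ] X} (hS : S.IsGeneratedBy A)
    {x y : X} (h : (x, y) ∈ A.graph) (t : ℝ≥0) : (S.op t x, S.op t y) ∈ A.graph := by
  rw [hS] at h ⊢
  refine (((S.op t).continuous.tendsto y).comp h).congr fun s => ?_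
  simp only [Function.comp_apply, map_smul, map_sub, ← op_add_apply, add_comm]

theorem continuous_orbit_toNNReal (S : C0Semigroup X) (x : X) :
    Continuous fun s : ℝ => S.op s.toNNReal x :=
  (S.continuous_orbit x).comp continuous_real_toNNReal

/-- By the semigroup law, the right difference quotient of the orbit at t is the one at time 0
started from S(t)x. One-sided derivatives are all that the monotonicity arguments need. -/
theorem IsGeneratedBy.hasDerivWithinAt {S : C0Semigroup X} {A : X →ₗ.[ℝ] X}
    (hS : S.IsGeneratedBy A) {x y : X} {t : ℝ≥0} (h : (S.op t x, y) ∈ A.graph) :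
    HasDerivWithinAt (fun s : ℝ => S.op s.toNNReal x) y (Set.Ici (t : ℝ)) t := by
  rw [← hasDerivWithinAt_Ioi_iff_Ici, hasDerivWithinAt_iff_tendsto_slope' (by simp)]
  rw [hS] at h
  have hu : Tendsto (fun u : ℝ => (u - t).toNNReal) (𝓝[>] (t : ℝ)) (𝓝[>] 0) := by
    refine tendsto_nhdsWithin_iff.2 ⟨?_, ?_⟩
    · have : Continuous fun u : ℝ => (u - t).toNNReal := by fun_prop
      simpa using (this.tendsto (t : ℝ)).mono_left nhdsWithin_le_nhds
    · filter_upwards [self_mem_nhdsWithin] with u hu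
      exact Real.toNNReal_pos.2 (sub_pos.2 hu)
  refine (h.comp hu).congr' ?_
  filter_upwards [self_mem_nhdsWithin] with u hu
  have hu' : (0 : ℝ) ≤ u - t := (sub_pos.2 hu).le
  have e : u.toNNReal = (u - t).toNNReal + t := by
    refine NNReal.eq ?_
    rw [NNReal.coe_add, Real.coe_toNNReal _ hu', Real.coe_toNNReal _ (by linarith [t.2]),
      sub_add_cancel]
  rw [slope_def_module, e, op_add_apply]
  simp [Real.coe_toNNReal _ hu']

end Generator

section Dissipative

variable {X : Type*} [NormedAddCommGroup X] [InnerProductSpace ℝ X]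

/-- A semigroup with densely defined dissipative generator is contractive. -/
theorem IsGeneratedBy.norm_op_le {S : C0Semigroup X} {A : X →ₗ.[ℝ] X} (hS : S.IsGeneratedBy A)
    (hd : Dense (A.domain : Set X)) (hA : ∀ x y, (x, y) ∈ A.graph → ⟪x, y⟫_ℝ ≤ 0)
    (t : ℝ≥0) (x : X) : ‖S.op t x‖ ≤ ‖x‖ := by
  refine hd.induction (P := fun x => ‖S.op t x‖ ≤ ‖x‖) (fun x hx => ?_)
    (isClosed_le (S.op t).continuous.norm continuous_norm) x
  have hxy : (x, A ⟨x, hx⟩) ∈ A.graph := A.mem_graph ⟨x, hx⟩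
  have h := le_of_right_deriv_nonpos (g := fun s => ‖S.op s.toNNReal x‖ ^ 2)
    (g' := fun s => 2 * ⟪S.op s.toNNReal x, S.op s.toNNReal (A ⟨x, hx⟩)⟫_ℝ)
    ((S.continuous_orbit_toNNReal x).norm.pow 2) (fun s hs => ?_) (fun s hs => ?_) t.2
  · simp only [Real.toNNReal_zero, op_zero_apply] at h
    have h' : ‖S.op t x‖ ^ 2 ≤ ‖x‖ ^ 2 := by simpa using h
    exact (pow_le_pow_iff_left₀ (norm_nonneg _) (norm_nonneg _) two_ne_zero).1 h'
  · lift s to ℝ≥0 using hs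
    have := (hS.hasDerivWithinAt (hS.op_mem_graph hxy s)).norm_sq
    simpa using this
  · have := hA _ _ (hS.op_mem_graph hxy s.toNNReal)
    linarith

end Dissipative

end C0Semigroup

/-! ### Compactness -/

/-- Compactness of the resolvent in concrete form: ‖A v‖ ≤ R confines the j-th coordinate pair to
radius R/ω_j. Tychonoff gives coordinatewise convergence of a subsequence, and the summable majorant
R²/ω_j² upgrades it to norm convergence. -/
theorem exists_subseq_tendsto_of_graph_bounded {ω : ℕ → ℝ} (hω : ∀ j, 0 < ω j)
    (hsum : Summable fun j => 1 / ω j ^ 2) {R : ℝ} {v y : ℕ → H}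
    (hv : ∀ n, (v n, y n) ∈ (hamOp ω).graph) (hR : ∀ n, ‖y n‖ ≤ R) :
    ∃ z w : H, (z, w) ∈ (hamOp ω).graph ∧
      ∃ φ : ℕ → ℕ, StrictMono φ ∧ Tendsto (v ∘ φ) atTop (𝓝 z) := by
  have hR0 : 0 ≤ R := (norm_nonneg _).trans (hR 0)
  have hy (n j : ℕ) : (y n).fst j ^ 2 + (y n).snd j ^ 2
      = ω j ^ 2 * ((v n).fst j ^ 2 + (v n).snd j ^ 2) := by
    have h := mem_graph_hamOp.1 (hv n) j
    rw [h.1, h.2]; ring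
  have hsq (n : ℕ) : ‖y n‖ ^ 2 ≤ R ^ 2 := pow_le_pow_left₀ (norm_nonneg _) (hR n) 2
  have hb (n j : ℕ) : (v n).fst j ^ 2 + (v n).snd j ^ 2 ≤ R ^ 2 * (1 / ω j ^ 2) := by
    have hp : 0 < ω j ^ 2 := pow_pos (hω j) 2
    rw [mul_one_div, le_div_iff₀ hp, mul_comm, ← hy]
    exact (coord_sq_le_norm_sq (y n) j).trans (hsq n)
  set B : ℕ → ℝ := fun j => Real.sqrt (R ^ 2 * (1 / ω j ^ 2)) with hB
  obtain ⟨a, -, φ, hφ, ha⟩ := IsCompact.tendsto_subseq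
    (isCompact_univ_pi fun j => (isCompact_Icc (a := -B j) (b := B j)).prod
      (isCompact_Icc (a := -B j) (b := B j)))
    (x := fun n j => ((v n).fst j, (v n).snd j)) (fun n j _ =>
      ⟨abs_le.1 (Real.abs_le_sqrt (by nlinarith [hb n j, sq_nonneg ((v n).snd j)])),
        abs_le.1 (Real.abs_le_sqrt (by nlinarith [hb n j, sq_nonneg ((v n).fst j)]))⟩)
  have h₁ (j : ℕ) : Tendsto (fun n => (v (φ n)).fst j) atTop (𝓝 (a j).1) :=
    (continuous_fst.tendsto _).comp ((tendsto_pi_nhds.1 ha) j)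
  have h₂ (j : ℕ) : Tendsto (fun n => (v (φ n)).snd j) atTop (𝓝 (a j).2) :=
    (continuous_snd.tendsto _).comp ((tendsto_pi_nhds.1 ha) j)
  have hsq_lim (j : ℕ) : Tendsto (fun n => (v (φ n)).fst j ^ 2 + (v (φ n)).snd j ^ 2) atTop
      (𝓝 ((a j).1 ^ 2 + (a j).2 ^ 2)) := ((h₁ j).pow 2).add ((h₂ j).pow 2)
  have hz : Summable fun j => (a j).1 ^ 2 + (a j).2 ^ 2 :=
    (hsum.mul_left (R ^ 2)).of_nonneg_of_le (fun j => by positivity)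
      fun j => le_of_tendsto (hsq_lim j) (.of_forall fun n => hb (φ n) j)
  -- A Fatou argument keeps the limit in the domain: each finite partial sum along the sequence is
  -- at most R², and so is its limit.
  have hw : Summable fun j => (ω j * (a j).2) ^ 2 + (-(ω j * (a j).1)) ^ 2 := by
    refine summable_of_sum_le (c := R ^ 2) (fun j => by positivity) fun u => ?_
    refine le_of_tendsto (tendsto_finsetSum u fun j _ => (hsq_lim j).const_mul (ω j ^ 2))
      (.of_forall fun n => ?_) |>.trans_eq' (Finset.sum_congr rfl fun j _ => by ring)
    simp only [← hy]
    exact (sum_le_hasSum u (fun _ _ => by positivity) (hasSum_coord_norm_sq _)).trans (hsq _)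
  exact ⟨ofCoords _ _ hz, ofCoords _ _ hw, mem_graph_hamOp.2 fun j => ⟨rfl, rfl⟩, φ, hφ,
    tendsto_of_coord (hsum.mul_left (R ^ 2)) h₁ h₂ (.of_forall fun n => hb (φ n))⟩

/-! ### The error dynamics -/

section Error

variable {r : ℕ} {ω : ℕ → ℝ} {c f g : Fin r → Ell2} {γ : Fin r → ℝ}

/-- The vector of the state space that represents an output functional. -/
def outputVec (c : Fin r → Ell2) (s : Fin r) : H := WithLp.toLp 2 (c s, 0)

theorem outputOp_apply (c : Fin r → Ell2) (z : H) (s : Fin r) :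
    outputOp c z s = ⟪outputVec c s, z⟫_ℝ := by
  rw [WithLp.prod_inner_apply]
  simp [outputVec, outputOp]

theorem gainOp_outputOp (hf : ∀ s j, f s j = γ s * c s j) (hg : ∀ s j, g s j = 0) (z : H) :
    gainOp f g (outputOp c z) = finRankOp γ (outputVec c) z := by
  have hf' (s : Fin r) : f s = γ s • c s := lp.ext (funext fun j => hf s j)
  have hg' (s : Fin r) : g s = 0 := lp.ext (funext fun j => hg s j)
  rw [finRankOp_apply]
  simp only [← outputOp_apply]
  refine WithLp.ofLp_injective 2 (Prod.ext ?_ ?_)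
  · simp [gainOp, hf', outputVec, smul_smul, mul_comm, Prod.fst_sum]
  · simp [gainOp, hg', outputVec, Prod.snd_sum]

/-- Since FC is everywhere defined, subtracting it leaves the domain unchanged and only shifts the
value. -/
theorem mem_graph_errorOp (hf : ∀ s j, f s j = γ s * c s j) (hg : ∀ s j, g s j = 0) (x y : H) :
    (x, y) ∈ (errorOp ω c f g).graph ↔
      (x, y + finRankOp γ (outputVec c) x) ∈ (hamOp ω).graph := by
  rw [← gainOp_outputOp hf hg, LinearPMap.mem_graph_iff, LinearPMap.mem_graph_iff]
  constructor
  · rintro ⟨⟨x, hx⟩, rfl, rfl⟩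
    refine ⟨⟨x, hx.1⟩, rfl, ?_⟩
    simp only [errorOp, LinearPMap.sub_apply]
    simp
  · rintro ⟨⟨x, hx⟩, rfl, h⟩
    refine ⟨⟨x, hx, trivial⟩, rfl, ?_⟩
    simp only [errorOp, LinearPMap.sub_apply]
    simp [h]

theorem inner_of_mem_graph_errorOp (hf : ∀ s j, f s j = γ s * c s j) (hg : ∀ s j, g s j = 0)
    {x y : H} (h : (x, y) ∈ (errorOp ω c f g).graph) :
    ⟪x, y⟫_ℝ = -∑ s, γ s * outputOp c x s ^ 2 := by
  have h1 := inner_eq_zero_of_mem_graph_hamOp ((mem_graph_errorOp hf hg x y).1 h)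
  rw [inner_add_right, finRankOp_apply, inner_sum] at h1
  rw [eq_neg_iff_add_eq_zero, ← h1]
  congr 1
  refine Finset.sum_congr rfl fun s _ => ?_
  rw [real_inner_smul_right, real_inner_smul_right, outputOp_apply, real_inner_comm x]
  ring

theorem exists_errorOp_semigroup (hf : ∀ s j, f s j = γ s * c s j) (hg : ∀ s j, g s j = 0) :
    ∃ S : C0Semigroup H, S.IsGeneratedBy (errorOp ω c f g) := by
  obtain ⟨S, hS⟩ := exists_perturbed_semigroup γ (outputVec c)
    (fun t => (rotation ω t).toContinuousLinearMap)
    (by ext1 z; exact rotation_zero ω z) (fun s t => by ext1 z; exact rotation_add ω s t z)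
    (fun t z => (rotation ω t).norm_map z) (continuous_rotation ω)
  refine ⟨S, fun x y => ?_⟩
  rw [mem_graph_errorOp hf hg, mem_graph_hamOp_iff_tendsto_rotation]
  exact (hS x y).symm

theorem norm_errorOp_semigroup_le (hγ : ∀ s, 0 < γ s) (hf : ∀ s j, f s j = γ s * c s j)
    (hg : ∀ s j, g s j = 0) {S : C0Semigroup H} (hS : S.IsGeneratedBy (errorOp ω c f g))
    (t : ℝ≥0) (x : H) : ‖S.op t x‖ ≤ ‖x‖ := by
  refine hS.norm_op_le ?_ (fun x y h => ?_) t x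
  · refine (dense_hamDomain ω).mono fun x hx => ?_
    exact ⟨hx, trivial⟩
  · rw [inner_of_mem_graph_errorOp hf hg h, neg_nonpos]
    exact Finset.sum_nonneg fun s _ => mul_nonneg (hγ s).le (sq_nonneg _)

/-- A trajectory of the error dynamics along which the norm is constant vanishes. -/
theorem eq_zero_of_norm_errorOp_semigroup_const (hinv : NoInvariantSubspace ω c)
    (hγ : ∀ s, 0 < γ s) (hf : ∀ s j, f s j = γ s * c s j) (hg : ∀ s j, g s j = 0)
    {S : C0Semigroup H} (hS : S.IsGeneratedBy (errorOp ω c f g)) {z w : H}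
    (hz : (z, w) ∈ (errorOp ω c f g).graph) {l : ℝ} (hl : ∀ t, ‖S.op t z‖ = l) : z = 0 := by
  -- The derivative of the constant ‖S(t)z‖² is -2 ∑ γ_s (output_s)²; as every γ_s is positive, each
  -- output vanishes.
  have hout (t : ℝ≥0) : outputOp c (S.op t z) = 0 := by
    have hg := hS.op_mem_graph hz t
    have hd := (hS.hasDerivWithinAt hg).norm_sq
    simp only [hl, Real.toNNReal_coe] at hd
    have h0 := (uniqueDiffWithinAt_Ici (t : ℝ)).eq_deriv _ hd (hasDerivWithinAt_const _ _ _)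
    rw [inner_of_mem_graph_errorOp hf ‹_› hg] at h0
    have h1 : ∑ s, γ s * outputOp c (S.op t z) s ^ 2 = 0 := by linarith
    ext s
    have h2 := (Finset.sum_eq_zero_iff_of_nonneg fun s _ =>
      mul_nonneg (hγ s).le (sq_nonneg _)).1 h1 s (Finset.mem_univ s)
    simpa [(hγ s).ne'] using h2
  have hK (t : ℝ≥0) : (S.op t z, S.op t w) ∈ (hamOp ω).graph := by
    have h := (mem_graph_errorOp hf hg _ _).1 (hS.op_mem_graph hz t)
    rwa [← gainOp_outputOp hf hg, hout, map_zero, add_zero] at h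
  have hT := hamSemigroup_isGeneratedBy ω
  have hz' : (z, w) ∈ (hamOp ω).graph := by simpa only [C0Semigroup.op_zero_apply] using hK 0
  -- Both orbits solve the equation of A, so by skewness the squared norm of their difference has
  -- zero right derivative; it starts at 0.
  have heq (t : ℝ≥0) : (hamSemigroup ω).op t z = S.op t z := by
    have h := le_of_right_deriv_nonpos
      (g := fun s => ‖(hamSemigroup ω).op s.toNNReal z - S.op s.toNNReal z‖ ^ 2)
      (g' := fun s => 0)
      ((((hamSemigroup ω).continuous_orbit_toNNReal z).sub
        (S.continuous_orbit_toNNReal z)).norm.pow 2) (fun s hs => ?_) (fun s hs => le_rfl) t.2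
    · have h' : ‖(hamSemigroup ω).op t z - S.op t z‖ ^ 2 ≤ 0 := by
        simpa [C0Semigroup.op_zero_apply] using h
      have h'' := pow_eq_zero_iff two_ne_zero |>.1 (le_antisymm h' (sq_nonneg _))
      exact sub_eq_zero.1 (norm_eq_zero.1 h'')
    · lift s to ℝ≥0 using hs
      have d₁ := hT.hasDerivWithinAt (hT.op_mem_graph hz' s)
      have d₂ := hS.hasDerivWithinAt (hS.op_mem_graph hz s)
      have d := (d₁.sub d₂).norm_sq
      have h0 := inner_eq_zero_of_mem_graph_hamOp
        ((hamOp ω).graph.sub_mem (hT.op_mem_graph hz' s) (hK s))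
      refine d.congr_deriv ?_
      simpa using h0
  -- The unobservable subspace: all states whose output vanishes along the whole unperturbed orbit.
  -- It lies in ker C by taking t = 0, and is invariant by the semigroup law.
  have hV := hinv _ hT
    (⨅ t : ℝ≥0, LinearMap.ker ((outputOp c).comp ((hamSemigroup ω).op t : H →ₗ[ℝ] H)))
    (fun x hx => ?_) (fun t x hx => ?_)
  · have : z ∈ (⊥ : Submodule ℝ H) := by
      rw [← hV, Submodule.mem_iInf]
      intro t
      show outputOp c ((hamSemigroup ω).op t z) = 0
      rw [heq, hout]
    simpa using this
  · have h := (Submodule.mem_iInf _).1 hx 0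
    show outputOp c x = 0
    rw [← C0Semigroup.op_zero_apply (hamSemigroup ω) x]
    exact h
  · rw [Submodule.mem_iInf] at hx ⊢
    intro s
    show outputOp c ((hamSemigroup ω).op s ((hamSemigroup ω).op t x)) = 0
    rw [← C0Semigroup.op_add_apply]
    exact hx (s + t)

theorem tendsto_errorOp_semigroup_of_mem_graph (hω : ∀ j, 0 < ω j)
    (hsum : Summable fun j => 1 / ω j ^ 2) (hinv : NoInvariantSubspace ω c)
    (hγ : ∀ s, 0 < γ s) (hf : ∀ s j, f s j = γ s * c s j) (hg : ∀ s j, g s j = 0)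
    {S : C0Semigroup H} (hS : S.IsGeneratedBy (errorOp ω c f g)) {x y : H}
    (hx : (x, y) ∈ (errorOp ω c f g).graph) :
    Tendsto (fun t => ‖S.op t x‖) atTop (𝓝 0) := by
  have hcontr := norm_errorOp_semigroup_le hγ hf hg hS
  have hanti : Antitone fun t => ‖S.op t x‖ := fun s t hst => by
    obtain ⟨u, rfl⟩ := exists_add_of_le hst
    show ‖S.op (s + u) x‖ ≤ _
    rw [add_comm, C0Semigroup.op_add_apply]
    exact hcontr u _
  have hlim := tendsto_atTop_ciInf hanti ⟨0, by rintro _ ⟨t, rfl⟩; exact norm_nonneg _⟩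
  set l := ⨅ t, ‖S.op t x‖
  set K := finRankOp γ (outputVec c)
  -- The bound comes from A S(n)x = S(n)y + K S(n)x, where y is the generator of S applied to x,
  -- together with contractivity.
  obtain ⟨z, w, hzw, φ, hφ, hz⟩ := exists_subseq_tendsto_of_graph_bounded hω hsum
    (v := fun n => S.op n x) (R := ‖y‖ + ‖K‖ * ‖x‖)
    (fun n => (mem_graph_errorOp hf hg _ _).1 (hS.op_mem_graph hx n))
    (fun n => (norm_add_le _ _).trans (add_le_add (hcontr _ _)
      ((K.le_opNorm _).trans (mul_le_mul_of_nonneg_left (hcontr _ _) (norm_nonneg _)))))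
  -- S(t)z is the limit of S(t + φ(n))x along times tending to infinity, where the norms tend to l.
  have hconst (t : ℝ≥0) : ‖S.op t z‖ = l := by
    have h₁ : Tendsto (fun n => ‖S.op t (S.op (φ n : ℝ≥0) x)‖) atTop (𝓝 ‖S.op t z‖) :=
      ((S.op t).continuous.norm.tendsto z).comp hz
    have h₃ : Tendsto (fun n => (φ n : ℝ≥0)) atTop atTop :=
      tendsto_natCast_atTop_atTop.comp hφ.tendsto_atTop
    have h₂ : Tendsto (fun n => t + (φ n : ℝ≥0)) atTop atTop :=
      tendsto_atTop_mono (fun n => le_add_self) h₃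
    refine tendsto_nhds_unique h₁ ((hlim.comp h₂).congr fun n => ?_)
    rw [Function.comp_apply, C0Semigroup.op_add_apply]
  have hz0 : z = 0 := eq_zero_of_norm_errorOp_semigroup_const hinv hγ hf hg hS
    (w := w - K z) ((mem_graph_errorOp hf hg _ _).2 (by rwa [sub_add_cancel])) hconst
  have hl : l = 0 := by rw [← hconst 0, hz0, map_zero, norm_zero]
  rwa [hl] at hlim

end Error

end HamObs

end

theorem theorem1 (r : ℕ) (ω : ℕ → ℝ) (c f g : Fin r → HamObs.Ell2) (γ : Fin r → ℝ)
    (hω_pos : ∀ j, 0 < ω j) (hω_mono : StrictMono ω)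
    (hω_sum : Summable fun j => 1 / ω j ^ 2)
    (hinv : HamObs.NoInvariantSubspace ω c)
    (hc : ∀ j : ℕ, ∃ s : Fin r, c s j ≠ 0)
    (hγ : ∀ s, 0 < γ s)
    (hf : ∀ s j, f s j = γ s * c s j)
    (hg : ∀ s j, g s j = 0) :
    HamObs.AsymptoticallyStable (HamObs.errorOp ω c f g) := by
  refine ⟨HamObs.exists_errorOp_semigroup hf hg, fun S hS => ?_⟩
  have hcontr := HamObs.norm_errorOp_semigroup_le hγ hf hg hS
  refine ⟨fun ε hε => ⟨ε, hε, fun x hx t => (hcontr t x).trans_lt hx⟩, fun x => ?_⟩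
  rw [Metric.tendsto_nhds]
  intro ε hε
  -- Contractivity keeps the error of approximating x by a domain element below ε/2 at all times.
  obtain ⟨x', hx', hd⟩ := (HamObs.dense_hamDomain ω).exists_dist_lt x (half_pos hε)
  have hlim := HamObs.tendsto_errorOp_semigroup_of_mem_graph hω_pos hω_sum hinv hγ hf hg hS
    ((HamObs.errorOp ω c f g).mem_graph ⟨x', hx', trivial⟩)
  filter_upwards [(Metric.tendsto_nhds.1 hlim) (ε / 2) (half_pos hε)] with t ht
  rw [Real.dist_0_eq_abs, abs_norm] at ht ⊢
  calc ‖S.op t x‖ = ‖S.op t (x - x') + S.op t x'‖ := by rw [← map_add, sub_add_cancel]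
    _ ≤ ‖x - x'‖ + ‖S.op t x'‖ := (norm_add_le _ _).trans (by gcongr; exact hcontr t _)
    _ < ε := by rw [← dist_eq_norm]; linarith
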